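/- A (left) brace is an abelian group $(A,+)$ with a multiplication $\cdot$ such that $a\cdot(b+c)=a\cdot b+a\cdot c$ and $(a\cdot b+a+b)\cdot c=a\cdot(b\cdot c)+a\cdot c+b\cdot c$ for all $a,b,c\in A$, and such that $x\mapsto a\cdot x+x$ is bijective for each $a\in A$. An isomorphism of braces is a bijection preserving $+$ and $\cdot$. For a prime $q>3$ consider the following braces, where exponents $x,y\in\mathbb{Z}_2$ are read as $0$ or $1$, exponents in $\mathbb{Z}_4$ as one of $0,1,2,3$, and $\underline{xy}=2x+y$ denotes the number with binary digits $x,y\in\{0,1\}$ (also used to write the elements of $\mathbb{Z}_4$): - $T^{2,2,q}_{\omega,\mu}=\mathbb{Z}_2^2\oplus\mathbb{Z}_q$ with $\left(\binom{x_1}{y_1},a_1\right)\cdot\left(\binom{x_2}{y_2},a_2\right)=\left(\binom{0}{0},(\omega^{x_1}\mu^{y_1}-1)a_2\right)$, for $\omega,\mu\in\{\pm1\}\leq\mathbb{Z}_q^\times$; - $T^{4,q}_{\omega}=\mathbb{Z}_4\oplus\mathbb{Z}_q$ with $(x_1,a_1)\cdot(x_2,a_2)=\left(0,(\omega^{x_1}-1)a_2\right)$,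 for $\omega\in\mathbb{Z}_q^\times$ with $\omega^4=1$; - $B^{2,2,q}_{\omega}=\mathbb{Z}_2^2\oplus\mathbb{Z}_q$ with $\left(\binom{x_1}{y_1},a_1\right)\cdot\left(\binom{x_2}{y_2},a_2\right)=\left(\binom{y_1y_2}{0},(\omega^{\underline{x_1y_1}}-1)a_2\right)$, for $\omega\in\mathbb{Z}_q^\times$ with $\omega^4=1$; - $B^{4,q}_{\omega,\mu}=\mathbb{Z}_4\oplus\mathbb{Z}_q$ with $(\underline{x_1y_1},a_1)\cdot(\underline{x_2y_2},a_2)=\left(2\,\underline{x_1y_1}\,\underline{x_2y_2},(\omega^{x_1}\mu^{y_1}-1)a_2\right)$, for $\omega,\mu\in\{\pm1\}\leq\mathbb{Z}_q^\times$. Theorem (fine classification). Let $q>3$ be a prime. - If $4\nmid q-1$, every brace of order $4q$ is isomorphic to exactly one of the nine braces $T^{2,2,q}_{1,1}$, $T^{2,2,q}_{-1,1}$, $T^{4,q}_{1}$, $T^{4,q}_{-1}$, $B^{2,2,q}_{1}$, $B^{2,2,q}_{-1}$, $B^{4,q}_{1,1}$, $B^{4,q}_{1,-1}$, $B^{4,q}_{-1,1}$.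 - If $4\mid q-1$, then $\mathbb{Z}_q^\times$ contains primitive $4$-th roots of unity, and for every fixed primitive $4$-th root of unity $\omega\in\mathbb{Z}_q^\times$, every brace of order $4q$ is isomorphic to exactly one of the eleven braces consisting of the nine above together with $T^{4,q}_{\omega}$ and $B^{2,2,q}_{\omega}$. -/

import Mathlib

/-- A left brace: an abelian group with a multiplication `*` such that
* `a * (b + c) = a * b + a * c`,
* `(a * b + a + b) * c = a * (b * c) + a * c + b * c`,
* for every `a`, the map `x ↦ a * x + x` is bijective.

Isomorphisms of left braces are the bijections that preserve `+` and `*`, that is `A ≃+* B`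
(which asks of `A` and `B` nothing but an addition and a multiplication). -/
class LeftBrace (A : Type*) extends AddCommGroup A, Mul A where
  mul_add' : ∀ a b c : A, a * (b + c) = a * b + a * c
  circ_mul' : ∀ a b c : A, (a * b + a + b) * c = a * (b * c) + a * c + b * c
  bijective' : ∀ a : A, Function.Bijective fun x : A => a * x + x

namespace LeftBrace

instance (B : CategoryTheory.Bundled LeftBrace) : LeftBrace B := B.str

theorem pow_eq_of_mod {G : Type*} [Monoid G] {k m n : ℕ} {w : G} (hw : w ^ k = 1)
    (h : m % k = n % k) : w ^ m = w ^ n := by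
  rw [pow_eq_pow_mod m hw, pow_eq_pow_mod n hw, h]

/-- The axiom `(a * b + a + b) * c = a * (b * c) + a * c + b * c` for the multiplication
`(m₁, a₁) * (m₂, a₂) = (f m₁ m₂, (χ m₁ - 1) a₂)`. -/
theorem circ_aux {q : ℕ} {M : Type*} [AddCommGroup M] (f : M → M → M) (χ : M → (ZMod q)ˣ)
    (hf : ∀ a b c, f (f a b + a + b) c = f a (f b c) + f a c + f b c)
    (hχ : ∀ a b, χ (f a b + a + b) = χ a * χ b) (a b c : M × ZMod q) :
    ((f (f a.1 b.1 + a.1 + b.1) c.1,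
        ((χ (f a.1 b.1 + a.1 + b.1) : ZMod q) - 1) * c.2) : M × ZMod q) =
      (f a.1 (f b.1 c.1), ((χ a.1 : ZMod q) - 1) * (((χ b.1 : ZMod q) - 1) * c.2)) +
        (f a.1 c.1, ((χ a.1 : ZMod q) - 1) * c.2) + (f b.1 c.1, ((χ b.1 : ZMod q) - 1) * c.2) := by
  refine Prod.ext (hf _ _ _) ?_
  simp only [hχ, Units.val_mul, Prod.snd_add]
  ring

/-- The bijectivity axiom for the same multiplication. -/
theorem bijective_aux {q : ℕ} {M : Type*} [AddCommGroup M] (g : M → M) (u : (ZMod q)ˣ)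
    (hg : Function.Bijective fun x => g x + x) :
    Function.Bijective fun x : M × ZMod q => (g x.1, ((u : ZMod q) - 1) * x.2) + x := by
  have h := hg.prodMap (Units.mulLeft_bijective u)
  convert h using 2 with x
  refine Prod.ext rfl ?_
  simp only [Prod.snd_add, Prod.map_snd]
  ring

/-- The element `-1` among the square roots of `1` modulo `q`. -/
def negOne₂ (q : ℕ) : rootsOfUnity 2 (ZMod q) := ⟨-1, by simp⟩

/-- The element `-1` among the fourth roots of `1` modulo `q`. -/
def negOne₄ (q : ℕ) : rootsOfUnity 4 (ZMod q) :=
  ⟨-1, by rw [mem_rootsOfUnity]; exact Even.neg_one_pow ⟨2, rfl⟩⟩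

/-! ### The braces `T^{2,2,q}_{ω,μ}` -/

/-- The additive group `ℤ₂² ⊕ ℤ_q` of `T^{2,2,q}_{ω,μ}`; here `ω² = μ² = 1`. -/
def T22 (q : ℕ) (_ω _μ : rootsOfUnity 2 (ZMod q)) : Type := (ZMod 2 × ZMod 2) × ZMod q

instance (q : ℕ) (ω μ : rootsOfUnity 2 (ZMod q)) : AddCommGroup (T22 q ω μ) :=
  inferInstanceAs (AddCommGroup ((ZMod 2 × ZMod 2) × ZMod q))

/-- `((x₁, y₁), a₁) * ((x₂, y₂), a₂) = ((0, 0), (ω ^ x₁ * μ ^ y₁ - 1) * a₂)`. -/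
instance (q : ℕ) (ω μ : rootsOfUnity 2 (ZMod q)) : Mul (T22 q ω μ) where
  mul s t := ((0, 0),
    (((ω.1 ^ s.1.1.val * μ.1 ^ s.1.2.val : (ZMod q)ˣ) : ZMod q) - 1) * t.2)

instance (q : ℕ) (ω μ : rootsOfUnity 2 (ZMod q)) : LeftBrace (T22 q ω μ) where
  mul_add' a b c := Prod.ext rfl (mul_add _ _ _)
  circ_mul' := circ_aux (fun _ _ => (0, 0))
    (fun m : ZMod 2 × ZMod 2 => ω.1 ^ m.1.val * μ.1 ^ m.2.val) (by decide) (by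
      intro a b
      have hω : ω.1 ^ 2 = 1 := ω.2
      have hμ : μ.1 ^ 2 = 1 := μ.2
      rw [mul_mul_mul_comm, ← pow_add, ← pow_add]
      congr 1
      · refine pow_eq_of_mod hω ?_
        revert a b; decide
      · refine pow_eq_of_mod hμ ?_
        revert a b; decide)
  bijective' a := bijective_aux (fun _ : ZMod 2 × ZMod 2 => (0, 0))
    (ω.1 ^ a.1.1.val * μ.1 ^ a.1.2.val) (by decide)

/-! ### The braces `T^{4,q}_ω` -/

/-- The additive group `ℤ₄ ⊕ ℤ_q` of `T^{4,q}_ω`; here `ω⁴ = 1`. -/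
def T4 (q : ℕ) (_ω : rootsOfUnity 4 (ZMod q)) : Type := ZMod 4 × ZMod q

instance (q : ℕ) (ω : rootsOfUnity 4 (ZMod q)) : AddCommGroup (T4 q ω) :=
  inferInstanceAs (AddCommGroup (ZMod 4 × ZMod q))

/-- `(x₁, a₁) * (x₂, a₂) = (0, (ω ^ x₁ - 1) * a₂)`. -/
instance (q : ℕ) (ω : rootsOfUnity 4 (ZMod q)) : Mul (T4 q ω) where
  mul s t := (0, (((ω.1 ^ s.1.val : (ZMod q)ˣ) : ZMod q) - 1) * t.2)

instance (q : ℕ) (ω : rootsOfUnity 4 (ZMod q)) : LeftBrace (T4 q ω) where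
  mul_add' a b c := Prod.ext rfl (mul_add _ _ _)
  circ_mul' := circ_aux (fun _ _ => 0) (fun m : ZMod 4 => ω.1 ^ m.val) (by decide) (by
      intro a b
      have hω : ω.1 ^ 4 = 1 := ω.2
      rw [← pow_add]
      refine pow_eq_of_mod hω ?_
      revert a b; decide)
  bijective' a := bijective_aux (fun _ : ZMod 4 => 0) (ω.1 ^ a.1.val) (by decide)

/-! ### The braces `B^{2,2,q}_ω` -/

/-- The additive group `ℤ₂² ⊕ ℤ_q` of `B^{2,2,q}_ω`; here `ω⁴ = 1`. -/
def B22 (q : ℕ) (_ω : rootsOfUnity 4 (ZMod q)) : Type := (ZMod 2 × ZMod 2) × ZMod q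

instance (q : ℕ) (ω : rootsOfUnity 4 (ZMod q)) : AddCommGroup (B22 q ω) :=
  inferInstanceAs (AddCommGroup ((ZMod 2 × ZMod 2) × ZMod q))

/-- `((x₁, y₁), a₁) * ((x₂, y₂), a₂) = ((y₁ * y₂, 0), (ω ^ (2 x₁ + y₁) - 1) * a₂)`, where
`2 x₁ + y₁` is the number with binary digits `x₁, y₁`. -/
instance (q : ℕ) (ω : rootsOfUnity 4 (ZMod q)) : Mul (B22 q ω) where
  mul s t := ((s.1.2 * t.1.2, 0),
    (((ω.1 ^ (2 * s.1.1.val + s.1.2.val) : (ZMod q)ˣ) : ZMod q) - 1) * t.2)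

instance (q : ℕ) (ω : rootsOfUnity 4 (ZMod q)) : LeftBrace (B22 q ω) where
  mul_add' a b c := by
    have h : ∀ x y z : ZMod 2 × ZMod 2, ((x.2 * (y + z).2, 0) : ZMod 2 × ZMod 2) =
      (x.2 * y.2, 0) + (x.2 * z.2, 0) := by decide
    exact Prod.ext (h _ _ _) (mul_add _ _ _)
  circ_mul' := circ_aux (fun m n => (m.2 * n.2, 0))
    (fun m : ZMod 2 × ZMod 2 => ω.1 ^ (2 * m.1.val + m.2.val)) (by decide) (by
      intro a b
      have hω : ω.1 ^ 4 = 1 := ω.2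
      rw [← pow_add]
      refine pow_eq_of_mod hω ?_
      revert a b; decide)
  bijective' a := bijective_aux (fun n : ZMod 2 × ZMod 2 => (a.1.2 * n.2, 0))
    (ω.1 ^ (2 * a.1.1.val + a.1.2.val)) (by
      generalize a.1 = m
      revert m; decide)

/-! ### The braces `B^{4,q}_{ω,μ}` -/

/-- The additive group `ℤ₄ ⊕ ℤ_q` of `B^{4,q}_{ω,μ}`; here `ω² = μ² = 1`. -/
def B4 (q : ℕ) (_ω _μ : rootsOfUnity 2 (ZMod q)) : Type := ZMod 4 × ZMod q

instance (q : ℕ) (ω μ : rootsOfUnity 2 (ZMod q)) : AddCommGroup (B4 q ω μ) :=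
  inferInstanceAs (AddCommGroup (ZMod 4 × ZMod q))

/-- `(z₁, a₁) * (z₂, a₂) = (2 * z₁ * z₂, (ω ^ x₁ * μ ^ y₁ - 1) * a₂)`, where `x₁, y₁` are the
binary digits of `z₁ = 2 x₁ + y₁`. -/
instance (q : ℕ) (ω μ : rootsOfUnity 2 (ZMod q)) : Mul (B4 q ω μ) where
  mul s t := (2 * s.1 * t.1,
    (((ω.1 ^ (s.1.val / 2) * μ.1 ^ (s.1.val % 2) : (ZMod q)ˣ) : ZMod q) - 1) * t.2)

instance (q : ℕ) (ω μ : rootsOfUnity 2 (ZMod q)) : LeftBrace (B4 q ω μ) where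
  mul_add' a b c := Prod.ext (mul_add _ _ _) (mul_add _ _ _)
  circ_mul' := circ_aux (fun m n => 2 * m * n)
    (fun m : ZMod 4 => ω.1 ^ (m.val / 2) * μ.1 ^ (m.val % 2)) (by decide) (by
      intro a b
      have hω : ω.1 ^ 2 = 1 := ω.2
      have hμ : μ.1 ^ 2 = 1 := μ.2
      rw [mul_mul_mul_comm, ← pow_add, ← pow_add]
      congr 1
      · refine pow_eq_of_mod hω ?_
        revert a b; decide
      · refine pow_eq_of_mod hμ ?_
        revert a b; decide)
  bijective' a := bijective_aux (fun n : ZMod 4 => 2 * a.1 * n)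
    (ω.1 ^ (a.1.val / 2) * μ.1 ^ (a.1.val % 2)) (by
      generalize a.1 = m
      revert m; decide)

/-! ### The lists -/

/-- The nine braces `T^{2,2,q}_{±1,1}`, `T^{4,q}_{±1}`, `B^{2,2,q}_{±1}`, `B^{4,q}_{1,±1}`,
`B^{4,q}_{-1,1}`. -/
def nine (q : ℕ) : Fin 9 → CategoryTheory.Bundled.{0} LeftBrace :=
  ![.of (T22 q 1 1), .of (T22 q (negOne₂ q) 1),
    .of (T4 q 1), .of (T4 q (negOne₄ q)),
    .of (B22 q 1), .of (B22 q (negOne₄ q)),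
    .of (B4 q 1 1), .of (B4 q 1 (negOne₂ q)), .of (B4 q (negOne₂ q) 1)]

/-- The two braces `T^{4,q}_ω`, `B^{2,2,q}_ω`. -/
def two (q : ℕ) (ω : rootsOfUnity 4 (ZMod q)) : Fin 2 → CategoryTheory.Bundled.{0} LeftBrace :=
  ![.of (T4 q ω), .of (B22 q ω)]

/-- The nine braces together with the two braces that involve `ω`. -/
def eleven (q : ℕ) (ω : rootsOfUnity 4 (ZMod q)) :
    Fin 9 ⊕ Fin 2 → CategoryTheory.Bundled.{0} LeftBrace :=
  Sum.elim (nine q) (two q ω)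

end LeftBrace

/-! The operation `a ∘ b = a * b + a + b` makes a brace a group, and this group acts on the additive
group by the automorphisms `x ↦ a * x + x`. For order `4q` the additive group is the direct sum of
its 4-torsion `M` and its `q`-torsion. Both summands are stable under the action and are subgroups
for `∘`. The `q`-torsion is a `q`-group for `∘`, and each summand has at most `q` elements, so it
acts trivially (`tors_mul_eq_zero`). Products therefore do not see the `q`-part of the left factor
(`add_mul_of_tors`), and they take the form `(m, x) * (n, y) = (f m n, (χ m - 1) y)`, where `f` is a
brace multiplication on `M` and `χ` is a character of the circle group of `M`
(`exists_presentation`).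

It remains to find the braces of order 4 and their characters. On `ZMod 4` only `f = 0` and `f a b =
2ab` are possible. On `ZMod 2 × ZMod 2` the 2-group fixes a nonzero vector, and once this is moved
to `(1, 0)` only `f = 0` and `(y₁y₂, 0)` remain. Characters are given by their values on generators
of the circle group, which is cyclic for `T4` and `B22` and a Klein four-group for `T22` and `B4`.
Automorphisms of `M` compatible with `f` identify the superfluous parameters, and five yes/no
invariants (`profile`) separate the braces that are left. -/

namespace LeftBrace

/-! ### The circle group and its action on the additive group -/

section Circle

variable {A : Type*} [LeftBrace A]

/-- Left multiplication by `a` as an additive homomorphism. -/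
def lmul (a : A) : A →+ A := AddMonoidHom.mk' (a * ·) (mul_add' a)

theorem mul_zero' (a : A) : a * 0 = 0 := map_zero (lmul a)

theorem mul_nsmul' (a x : A) (n : ℕ) : a * (n • x) = n • (a * x) := map_nsmul (lmul a) n x

/-- The case `a = b = 0` of the second axiom gives `0 * (0 * c) + 0 * c = 0`, and `x ↦ 0 * x + x` is
injective. -/
theorem zero_mul' (c : A) : (0 : A) * c = 0 := by
  have h := circ_mul' (0 : A) 0 c
  simp only [mul_zero', add_zero] at h
  refine (bijective' (0 : A)).1 ?_
  simp only [mul_zero', add_zero]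
  have h2 : (0 : A) * c + 0 = 0 * c + (0 * (0 * c) + 0 * c) := by
    rw [add_zero]; nth_rewrite 1 [h]; abel
  exact (add_left_cancel h2).symm

variable (A) in
/-- A copy of a brace that carries the circle operation `a * b + a + b`. -/
@[ext] structure Circ where
  /-- The underlying element of the brace. -/
  val : A

noncomputable instance : Group (Circ A) :=
  letI : Mul (Circ A) := ⟨fun a b => ⟨a.val * b.val + a.val + b.val⟩⟩
  letI : One (Circ A) := ⟨⟨0⟩⟩
  -- `a ∘ x = 0` means `a * x + x = -a`, which is solvable by surjectivity. Right inverses suffice.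
  letI : Inv (Circ A) := ⟨fun a => ⟨((bijective' a.val).2 (-a.val)).choose⟩⟩
  Group.ofRightAxioms
    (fun a b c => Circ.ext <| by
      change (a.val * b.val + a.val + b.val) * c.val + (a.val * b.val + a.val + b.val) + c.val =
        a.val * (b.val * c.val + b.val + c.val) + a.val + (b.val * c.val + b.val + c.val)
      rw [circ_mul', mul_add', mul_add']
      abel)
    (fun a => Circ.ext <| by
      change a.val * 0 + a.val + 0 = a.val
      rw [mul_zero', zero_add, add_zero])
    (fun a => Circ.ext <| by
      have h := ((bijective' a.val).2 (-a.val)).choose_spec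
      change a.val * ((bijective' a.val).2 (-a.val)).choose + a.val +
        ((bijective' a.val).2 (-a.val)).choose = 0
      dsimp only at h
      rw [add_right_comm, h, neg_add_cancel])

theorem val_circ_mul (a b : Circ A) : (a * b).val = a.val * b.val + a.val + b.val := rfl

theorem val_circ_one : (1 : Circ A).val = 0 := rfl

noncomputable instance : DistribMulAction (Circ A) A where
  smul a x := a.val * x + x
  one_smul x := by
    change (0 : A) * x + x = x
    rw [zero_mul', zero_add]
  mul_smul a b x := by
    change (a.val * b.val + a.val + b.val) * x + x =
      a.val * (b.val * x + x) + (b.val * x + x)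
    rw [circ_mul', mul_add']
    abel
  smul_zero a := by
    change a.val * 0 + 0 = 0
    rw [mul_zero', add_zero]
  smul_add a x y := by
    change a.val * (x + y) + (x + y) = a.val * x + x + (a.val * y + y)
    rw [mul_add']
    abel

end Circle

/-! ### Splitting a finite abelian group into coprime torsion parts -/

section Torsion

/-- The elements killed by `n`. -/
def tors (G : Type*) [AddCommGroup G] (n : ℕ) : AddSubgroup G := (nsmulAddMonoidHom n).ker

theorem mem_tors {G : Type*} [AddCommGroup G] {n : ℕ} {x : G} : x ∈ tors G n ↔ n • x = 0 :=
  Iff.rfl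

theorem eq_zero_of_coprime_nsmul {G : Type*} [AddCommGroup G] {m n : ℕ} (h : m.Coprime n) {x : G}
    (hm : m • x = 0) (hn : n • x = 0) : x = 0 := by
  have := Nat.dvd_gcd (addOrderOf_dvd_of_nsmul_eq_zero hm) (addOrderOf_dvd_of_nsmul_eq_zero hn)
  rw [h.gcd_eq_one, Nat.dvd_one, AddMonoid.addOrderOf_eq_one_iff] at this
  exact this

variable {G : Type*} [AddCommGroup G]

theorem bijective_tors_coprod {m n : ℕ} (h : m.Coprime n) (hG : Nat.card G = m * n) :
    Function.Bijective ((tors G m).subtype.coprod (tors G n).subtype) := by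
  have hk : ∀ x : G, (m * n) • x = 0 := fun x => by rw [← hG]; exact card_nsmul_eq_zero'
  refine ⟨(injective_iff_map_eq_zero _).2 ?_, fun x => ?_⟩
  · rintro ⟨⟨x, hx⟩, ⟨y, hy⟩⟩ hxy
    rw [mem_tors] at hx hy
    simp only [AddMonoidHom.coprod_apply, AddSubgroup.subtype_apply] at hxy
    have hy' : y = -x := (neg_eq_of_add_eq_zero_right hxy).symm
    have hx0 : x = 0 := eq_zero_of_coprime_nsmul h hx (by
      rw [hy', smul_neg, neg_eq_zero] at hy; exact hy)
    subst hx0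
    simp [hy']
  · have hb : (m : ℤ) * m.gcdA n + n * m.gcdB n = 1 := by
      rw [← Nat.gcd_eq_gcd_ab, h.gcd_eq_one]; rfl
    refine ⟨⟨⟨n • (m.gcdB n • x), ?_⟩, ⟨m • (m.gcdA n • x), ?_⟩⟩, ?_⟩
    · rw [mem_tors, ← mul_smul]; exact hk _
    · rw [mem_tors, ← mul_smul, mul_comm]; exact hk _
    · simp only [AddMonoidHom.coprod_apply, AddSubgroup.subtype_apply]
      rw [← natCast_zsmul, ← natCast_zsmul, ← mul_smul, ← mul_smul, ← add_smul, add_comm, hb,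
        one_smul]

theorem coprime_card_tors [Finite G] {m n : ℕ} (h : m.Coprime n) :
    (Nat.card (tors G m)).Coprime n := by
  refine Nat.Coprime.symm (Nat.coprime_of_dvd fun p hp hpn hpc => ?_)
  have := Fact.mk hp
  obtain ⟨x, hx⟩ := exists_prime_addOrderOf_dvd_card' p hpc
  have h1 : m • x = 0 := Subtype.ext (by simpa using mem_tors.1 x.2)
  have h2 : n • x = 0 := addOrderOf_dvd_iff_nsmul_eq_zero.1 (hx ▸ hpn)
  rw [eq_zero_of_coprime_nsmul h h1 h2, addOrderOf_zero] at hx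
  exact hp.one_lt.ne hx

theorem card_tors [Finite G] {m n : ℕ} (h : m.Coprime n) (hG : Nat.card G = m * n) :
    Nat.card (tors G m) = m ∧ Nat.card (tors G n) = n := by
  have hc := Nat.card_congr (Equiv.ofBijective _ (bijective_tors_coprod h hG))
  -- Each torsion order is coprime to the opposite factor, hence divides its own factor; as the
  -- product is `m * n`, both are equalities.
  rw [Nat.card_prod, hG] at hc
  have hm : Nat.card (tors G m) ∣ m :=
    (coprime_card_tors h).dvd_of_dvd_mul_right (hc ▸ dvd_mul_right _ _)
  have hn : Nat.card (tors G n) ∣ n :=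
    (coprime_card_tors h.symm).dvd_of_dvd_mul_left (hc ▸ dvd_mul_left _ _)
  have hpos : 0 < m * n := hG ▸ Nat.card_pos
  have hm0 : 0 < m := Nat.pos_of_mul_pos_right hpos
  have hn0 : 0 < n := Nat.pos_of_mul_pos_left hpos
  have h1 := Nat.le_of_dvd hm0 hm
  have h2 := Nat.le_of_dvd hn0 hn
  constructor <;> nlinarith

end Torsion

/-! ### Torsion parts under the circle action -/

section Action

/-- A `p`-group acts trivially by automorphisms on a group with at most `p` elements. -/
theorem smul_eq_self_of_card_le {p : ℕ} [Fact p.Prime] {H X : Type*} [Group H] (hH : IsPGroup p H)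
    [AddGroup X] [DistribMulAction H X] [Finite X] (hX : Nat.card X ≤ p) (h : H) (x : X) :
    h • x = x := by
  by_cases hx : x = 0
  · rw [hx, smul_zero]
  -- Since `0` is fixed, the orbit of `x ≠ 0` misses it and has fewer than `p` elements; being of
  -- `p`-power size, it is a single point.
  have h0 : (0 : X) ∉ MulAction.orbit H x := by
    rintro ⟨g, hg⟩
    exact hx ((smul_eq_zero_iff_eq g).1 hg)
  have hlt : Nat.card (MulAction.orbit H x) < Nat.card X := by
    rw [Nat.card_coe_set_eq]
    exact Set.ncard_lt_card (fun hu => h0 (hu ▸ Set.mem_univ _))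
  obtain ⟨n, hn⟩ := hH.card_orbit x
  have hn0 : n = 0 := by
    by_contra hn0
    have := Nat.le_self_pow hn0 p
    omega
  rw [hn0, pow_zero] at hn
  have hs := (Nat.card_eq_one_iff_unique.1 hn).1
  exact congrArg Subtype.val
    (hs.elim ⟨h • x, MulAction.mem_orbit _ _⟩ ⟨x, MulAction.mem_orbit_self _⟩)

variable {A : Type*} [LeftBrace A]

theorem mul_mem_tors (a : A) {x : A} {n : ℕ} (hx : x ∈ tors A n) : a * x ∈ tors A n := by
  rw [mem_tors] at hx ⊢
  rw [← mul_nsmul', hx, mul_zero']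

theorem smul_mem_tors (a : Circ A) {x : A} {n : ℕ} (hx : x ∈ tors A n) : a • x ∈ tors A n :=
  add_mem (mul_mem_tors _ hx) hx

noncomputable instance (n : ℕ) : DistribMulAction (Circ A) (tors A n) where
  smul a x := ⟨a • x.1, smul_mem_tors a x.2⟩
  one_smul x := Subtype.ext (one_smul _ x.1)
  mul_smul a b x := Subtype.ext (mul_smul a b x.1)
  smul_zero a := Subtype.ext (smul_zero a)
  smul_add a x y := Subtype.ext (smul_add a x.1 y.1)

variable (A) in
/-- The elements killed by `n`, as a subgroup of the circle group. -/
def circTors (n : ℕ) : Subgroup (Circ A) where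
  carrier := {a | a.val ∈ tors A n}
  mul_mem' {a b} ha hb := add_mem (add_mem (mul_mem_tors _ hb) ha) hb
  one_mem' := zero_mem (tors A n)
  inv_mem' {a} ha := by
    -- This exhibits the circle inverse as the image of `-a` under the action of `a⁻¹`, which
    -- preserves torsion.
    have h : a • a⁻¹.val = -a.val := by
      have := congrArg Circ.val (mul_inv_cancel a)
      rw [val_circ_mul, val_circ_one, add_right_comm] at this
      exact eq_neg_of_add_eq_zero_left this
    change a⁻¹.val ∈ tors A n
    rw [← inv_smul_smul a a⁻¹.val, h]
    exact smul_mem_tors _ (neg_mem ha)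

theorem card_circTors (n : ℕ) : Nat.card (circTors A n) = Nat.card (tors A n) :=
  Nat.card_congr ⟨fun a => ⟨a.1.val, a.2⟩, fun a => ⟨⟨a.1⟩, a.2⟩, fun _ => rfl, fun _ => rfl⟩

variable {q : ℕ}

/-- In a brace of order `m * q` with `m < q` coprime to the prime `q`, the `q`-torsion
multiplies everything to zero. -/
theorem tors_mul_eq_zero (hq : q.Prime) {m : ℕ} (hmq : m < q) (h : m.Coprime q)
    (hA : Nat.card A = m * q) {a : A} (ha : a ∈ tors A q) (x : A) : a * x = 0 := by
  have := Fact.mk hq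
  have hm : m ≠ 0 := by
    rintro rfl
    exact hq.one_lt.ne' (by simpa using h)
  have : Finite A := Nat.finite_of_card_ne_zero (by rw [hA]; positivity [hq.pos])
  obtain ⟨h1, h2⟩ := card_tors h hA
  have hP : IsPGroup q (circTors A q) :=
    IsPGroup.of_card (n := 1) (by rw [card_circTors, h2, pow_one])
  -- Used for `n = m` and `n = q`: both torsion parts have at most `q` elements.
  have key : ∀ n, Nat.card (tors A n) ≤ q → ∀ y ∈ tors A n, a * y = 0 := fun n hn y hy => by
    have := congrArg Subtype.val
      (smul_eq_self_of_card_le hP hn (⟨⟨a⟩, ha⟩ : circTors A q) (⟨y, hy⟩ : tors A n))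
    exact add_eq_right.1 this
  obtain ⟨⟨y, z⟩, rfl⟩ := (bijective_tors_coprod h hA).2 x
  simp only [AddMonoidHom.coprod_apply, AddSubgroup.subtype_apply]
  rw [mul_add', key m (by omega) y y.2, key q h2.le z z.2, add_zero]

/-- Translating the left factor by `q`-torsion does not change the product. -/
theorem add_mul_of_tors (hq : q.Prime) {m : ℕ} (hmq : m < q) (h : m.Coprime q)
    (hA : Nat.card A = m * q) (a : A) {b : A} (hb : b ∈ tors A q) (x : A) :
    (a + b) * x = a * x := by
  -- Thus `a + b = a ∘ c`. Injectivity makes `c` a `q`-torsion element as well, so `c` acts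
  -- trivially and `(a ∘ c) * x = a * x`.
  obtain ⟨c, hc⟩ := (bijective' a).2 b
  dsimp only at hc
  have hcq : c ∈ tors A q := by
    rw [mem_tors] at hb ⊢
    refine (bijective' a).1 ?_
    dsimp only
    rw [mul_nsmul', ← smul_add, hc, hb, mul_zero', add_zero]
  have := circ_mul' a c x
  rw [tors_mul_eq_zero hq hmq h hA hcq, mul_zero', zero_add, add_zero, add_right_comm, hc,
    add_comm b] at this
  exact this

/-- A `p`-group acting on a nontrivial `p`-group by automorphisms fixes more than `0`. The `q`-part
of a left factor is irrelevant, so a vector fixed by the `p`-part is killed by every left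
multiplication. -/
theorem exists_ne_zero_mul_eq_zero {k : ℕ} (hq : q.Prime) {p : ℕ} (hp : p.Prime) (hk : k ≠ 0)
    (hmq : p ^ k < q) (h : (p ^ k).Coprime q) (hA : Nat.card A = p ^ k * q) :
    ∃ c ∈ tors A (p ^ k), c ≠ 0 ∧ ∀ a : A, a * c = 0 := by
  have := Fact.mk hp
  have : Finite A := Nat.finite_of_card_ne_zero (by rw [hA]; positivity [hq.pos, hp.pos])
  obtain ⟨h1, h2⟩ := card_tors h hA
  have hP : IsPGroup p (circTors A (p ^ k)) := IsPGroup.of_card (by rw [card_circTors, h1])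
  obtain ⟨c, hc, hc0⟩ := hP.exists_fixed_point_of_prime_dvd_card_of_fixed_point
    (tors A (p ^ k)) (by rw [h1]; exact dvd_pow_self p hk) (a := 0) (fun g => smul_zero g)
  refine ⟨c, c.2, fun h0 => hc0 (Subtype.ext h0.symm), fun a => ?_⟩
  obtain ⟨⟨y, z⟩, rfl⟩ := (bijective_tors_coprod h hA).2 a
  simp only [AddMonoidHom.coprod_apply, AddSubgroup.subtype_apply]
  rw [add_mul_of_tors hq hmq h hA _ z.2]
  have := congrArg Subtype.val (hc ⟨⟨y.1⟩, y.2⟩)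
  exact add_eq_right.1 this

end Action

/-! ### Coordinates on a brace: the pair of `f` and `χ` -/

section Presentation

/-- An identification of a brace with `M ⊕ ℤ_q` under which the multiplication becomes
`(m, x) * (n, y) = (f m n, (χ m - 1) y)`. -/
structure Presentation (B : Type*) [LeftBrace B] {M : Type*} [AddCommGroup M] {q : ℕ}
    (f : M → M → M) (χ : M → (ZMod q)ˣ) where
  /-- The underlying additive isomorphism. -/
  equiv : B ≃+ M × ZMod q
  equiv_mul : ∀ s t : B, equiv (s * t) =
    (f (equiv s).1 (equiv t).1, ((χ (equiv s).1 : ZMod q) - 1) * (equiv t).2)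

variable {A B M N : Type*} [LeftBrace A] [LeftBrace B] [AddCommGroup M] [AddCommGroup N] {q : ℕ}

theorem mul_comm_one_of_addMonoidHom (ψ : ZMod q →+ ZMod q) (x : ZMod q) : ψ x = ψ 1 * x := by
  have := ZMod.map_smul ψ x 1
  simpa [mul_comm] using this

/-- Left multiplication is additive, so it preserves torsion and acts separately on the two
summands. On `ZMod q` it is a scalar `ψ m 1`, and `χ m = ψ m 1 + 1`. -/
theorem exists_presentation (hq : q.Prime) (e : A ≃+ M × ZMod q) (hM : Nat.card M < q)
    (h : (Nat.card M).Coprime q) :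
    ∃ (f : M → M → M) (χ : M → (ZMod q)ˣ), Nonempty (Presentation A f χ) := by
  have := Fact.mk hq
  have hA : Nat.card A = Nat.card M * q := by
    rw [Nat.card_congr e.toEquiv, Nat.card_prod, Nat.card_zmod]
  have hin : ∀ (k : ℕ) (x : A), k • x = 0 → k • (e x).1 = 0 ∧ k • (e x).2 = 0 := fun k x hx => by
    have := congrArg e hx
    rw [map_nsmul, map_zero] at this
    exact ⟨congrArg Prod.fst this, congrArg Prod.snd this⟩
  have hMk : ∀ m : M, Nat.card M • m = 0 := fun m => card_nsmul_eq_zero'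
  have hZk : ∀ x : ZMod q, q • x = 0 := fun x => by simp
  have h1 : ∀ m : M, Nat.card M • e.symm (m, 0) = 0 := fun m => by
    rw [← map_nsmul, Prod.smul_mk, hMk, smul_zero]; exact map_zero _
  have h2 : ∀ x : ZMod q, q • e.symm ((0 : M), x) = 0 := fun x => by
    rw [← map_nsmul, Prod.smul_mk, hZk, smul_zero]; exact map_zero _
  have hsplit : ∀ a : A, a = e.symm ((e a).1, 0) + e.symm (0, (e a).2) := fun a => by
    rw [← map_add, Prod.mk_add_mk, add_zero, zero_add, e.symm_apply_apply]
  let ψ : M → ZMod q →+ ZMod q := fun m =>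
    (AddMonoidHom.snd M (ZMod q)).comp (e.toAddMonoidHom.comp ((lmul (e.symm (m, 0))).comp
      (e.symm.toAddMonoidHom.comp (AddMonoidHom.inr M (ZMod q)))))
  have hψ : ∀ m x, e (e.symm (m, 0) * e.symm (0, x)) = (0, ψ m x) := fun m x => by
    refine Prod.ext ?_ rfl
    refine eq_zero_of_coprime_nsmul h (hMk _) (hin q _ ?_).1
    rw [← mul_nsmul', h2, mul_zero']
  -- Otherwise `x ↦ m * x + x` would kill the generator of the summand `ZMod q`.
  have hu : ∀ m, ψ m 1 + 1 ≠ 0 := fun m h0 => by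
    have h3 : e.symm (m, 0) * e.symm (0, 1) + e.symm ((0 : M), (1 : ZMod q)) = 0 := by
      apply e.injective
      rw [map_add, hψ, e.apply_symm_apply, Prod.mk_add_mk, h0, map_zero, add_zero]; rfl
    have h4 := (bijective' (e.symm (m, 0))).1 (h3.trans
      (by simp [mul_zero'] : (0 : A) = e.symm (m, 0) * 0 + 0))
    have h5 : ((0 : M), (1 : ZMod q)) = 0 := e.symm.injective (h4.trans (map_zero _).symm)
    exact one_ne_zero (congrArg Prod.snd h5)
  refine ⟨fun m n => (e (e.symm (m, 0) * e.symm (n, 0))).1, fun m => Units.mk0 _ (hu m),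
    ⟨⟨e, fun s t => ?_⟩⟩⟩
  have hs : s * t = e.symm ((e s).1, 0) * t := by
    conv_lhs => rw [hsplit s]
    exact add_mul_of_tors hq hM h hA _ (h2 _) _
  have ht : s * t =
      e.symm ((e s).1, 0) * e.symm ((e t).1, 0) + e.symm ((e s).1, 0) * e.symm (0, (e t).2) := by
    rw [hs, ← mul_add', ← hsplit]
  rw [ht, map_add, hψ, mul_comm_one_of_addMonoidHom (ψ _)]
  refine Prod.ext (add_zero _) ?_
  simp only [Prod.snd_add, Units.val_mk0, add_sub_cancel_right]
  rw [add_eq_right]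
  refine eq_zero_of_coprime_nsmul h (hin _ _ ?_).2 (hZk _)
  rw [← mul_nsmul', h1, mul_zero']

namespace Presentation

variable {f : M → M → M} {χ : M → (ZMod q)ˣ}
  {g : N → N → N} {ξ : N → (ZMod q)ˣ}

theorem equiv_symm_mul (P : Presentation A f χ) (m n : M) (x y : ZMod q) :
    P.equiv (P.equiv.symm (m, x) * P.equiv.symm (n, y)) = (f m n, ((χ m : ZMod q) - 1) * y) := by
  rw [P.equiv_mul, AddEquiv.apply_symm_apply, AddEquiv.apply_symm_apply]

theorem map_add (P : Presentation A f χ) (a b c : M) : f a (b + c) = f a b + f a c := by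
  have := congrArg (fun x => (P.equiv x).1)
    (mul_add' (P.equiv.symm (a, 0)) (P.equiv.symm (b, 0)) (P.equiv.symm (c, 0)))
  simpa only [P.equiv_mul, _root_.map_add, AddEquiv.apply_symm_apply, Prod.fst_add] using this

theorem map_circ (P : Presentation A f χ) (a b c : M) :
    f (f a b + a + b) c = f a (f b c) + f a c + f b c := by
  have := congrArg (fun x => (P.equiv x).1)
    (circ_mul' (P.equiv.symm (a, 0)) (P.equiv.symm (b, 0)) (P.equiv.symm (c, 0)))
  simpa only [P.equiv_mul, _root_.map_add, AddEquiv.apply_symm_apply, Prod.fst_add] using this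

theorem char_circ (P : Presentation A f χ) (a b : M) : χ (f a b + a + b) = χ a * χ b := by
  have := congrArg (fun x => (P.equiv x).2)
    (circ_mul' (P.equiv.symm (a, 0)) (P.equiv.symm (b, 0)) (P.equiv.symm (0, 1)))
  simp only [P.equiv_mul, _root_.map_add, AddEquiv.apply_symm_apply, Prod.fst_add, Prod.snd_add,
    mul_one] at this
  refine Units.ext ?_
  rw [Units.val_mul]
  linear_combination this

theorem injective (P : Presentation A f χ) (a : M) : Function.Injective fun x => f a x + x := by
  intro x y hxy
  have h : P.equiv.symm (x, 0) = P.equiv.symm (y, 0) := by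
    refine (bijective' (P.equiv.symm (a, 0))).1 (P.equiv.injective ?_)
    simp only [_root_.map_add, P.equiv_symm_mul, mul_zero, AddEquiv.apply_symm_apply]
    exact Prod.ext hxy rfl
  exact congrArg Prod.fst (P.equiv.symm.injective h)

theorem prodCongr_refl_apply {R : Type*} [AddCommGroup R] (φ : M ≃+ N) (z : M × R) :
    φ.prodCongr (AddEquiv.refl R) z = (φ z.1, z.2) := rfl

/-- Two presented braces are isomorphic when the data correspond under an isomorphism. -/
def ringEquiv (P : Presentation A f χ) (R : Presentation B g ξ) (φ : M ≃+ N)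
    (hf : ∀ m n, φ (f m n) = g (φ m) (φ n)) (hχ : ∀ m, ξ (φ m) = χ m) : A ≃+* B where
  toEquiv := (P.equiv.trans ((φ.prodCongr (AddEquiv.refl _)).trans R.equiv.symm)).toEquiv
  map_add' := (P.equiv.trans ((φ.prodCongr (AddEquiv.refl _)).trans R.equiv.symm)).map_add
  map_mul' s t := by
    apply R.equiv.injective
    rw [R.equiv_mul]
    simp [P.equiv_mul, prodCongr_refl_apply, hf, hχ]

theorem exists_ne_zero (P : Presentation A f χ) (hq : q.Prime) {p k : ℕ} (hp : p.Prime)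
    (hk : k ≠ 0) (hM : Nat.card M = p ^ k) (hM' : Nat.card M < q)
    (h : (Nat.card M).Coprime q) : ∃ c : M, c ≠ 0 ∧ ∀ m, f m c = 0 := by
  have hA : Nat.card A = p ^ k * q := by
    rw [Nat.card_congr P.equiv.toEquiv, Nat.card_prod, Nat.card_zmod, hM]
  rw [hM] at h hM'
  obtain ⟨c, hc, hc0, hf⟩ := exists_ne_zero_mul_eq_zero hq hp hk hM' h hA
  have hc2 : (P.equiv c).2 = 0 := by
    refine eq_zero_of_coprime_nsmul h ?_ (by simp : q • _ = _)
    have := congrArg (fun x => (P.equiv x).2) (mem_tors.1 hc)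
    simpa only [map_nsmul, map_zero, Prod.smul_snd, Prod.snd_zero] using this
  refine ⟨(P.equiv c).1, fun h0 => hc0 ?_, fun m => ?_⟩
  · exact P.equiv.injective ((Prod.ext h0 hc2).trans (map_zero P.equiv).symm)
  · have := congrArg (fun x => (P.equiv x).1) (hf (P.equiv.symm (m, 0)))
    simpa only [P.equiv_mul, AddEquiv.apply_symm_apply, map_zero, Prod.fst_zero] using this

/-- Transport of a presentation along an automorphism of `M`. -/
def trans (P : Presentation A f χ) (φ : M ≃+ M) :
    Presentation A (fun m n => φ (f (φ.symm m) (φ.symm n))) (fun m => χ (φ.symm m)) where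
  equiv := P.equiv.trans (φ.prodCongr (AddEquiv.refl _))
  equiv_mul s t := by simp [P.equiv_mul, prodCongr_refl_apply]

end Presentation

theorem addEquiv_of_card_eq_four {G : Type*} [AddCommGroup G] (hG : Nat.card G = 4) :
    Nonempty (G ≃+ ZMod 4) ∨ Nonempty (G ≃+ ZMod 2 × ZMod 2) := by
  have : Finite G := Nat.finite_of_card_ne_zero (by omega)
  by_cases hc : IsAddCyclic G
  · left
    have e := zmodAddCyclicAddEquiv hc
    rw [hG] at e
    exact ⟨e.symm⟩
  · right
    have hG' : Nat.card G = 2 ^ 2 := hG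
    have h := (not_isAddCyclic_iff_exponent_eq_prime Nat.prime_two hG').1 hc
    have : IsAddKleinFour G := ⟨hG, h⟩
    exact IsAddKleinFour.nonempty_addEquiv

theorem addEquiv_of_card (hq : q.Prime) (hq2 : Nat.Coprime 4 q) {G : Type*} [AddCommGroup G]
    (hG : Nat.card G = 4 * q) :
    Nonempty (G ≃+ ZMod 4 × ZMod q) ∨ Nonempty (G ≃+ (ZMod 2 × ZMod 2) × ZMod q) := by
  have := Fact.mk hq
  have : Finite G := Nat.finite_of_card_ne_zero (by rw [hG]; positivity [hq.pos])
  obtain ⟨h1, h2⟩ := card_tors hq2 hG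
  let e := (AddEquiv.ofBijective _ (bijective_tors_coprod hq2 hG)).symm
  have hc : IsAddCyclic (tors G q) := isAddCyclic_of_prime_card h2
  have e2 := (zmodAddCyclicAddEquiv hc).symm
  rw [h2] at e2
  exact (addEquiv_of_card_eq_four h1).imp (fun ⟨e1⟩ => ⟨e.trans (e1.prodCongr e2)⟩)
    (fun ⟨e1⟩ => ⟨e.trans (e1.prodCongr e2)⟩)

end Presentation

/-! ### The model braces in coordinates -/

section StandardPresentations

variable (q : ℕ)

def presentationT22 (ω μ : rootsOfUnity 2 (ZMod q)) : Presentation (T22 q ω μ)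
    (fun _ _ => (0, 0)) (fun m : ZMod 2 × ZMod 2 => ω.1 ^ m.1.val * μ.1 ^ m.2.val) :=
  ⟨AddEquiv.refl _, fun _ _ => rfl⟩

def presentationT4 (ω : rootsOfUnity 4 (ZMod q)) : Presentation (T4 q ω)
    (fun _ _ => 0) (fun m : ZMod 4 => ω.1 ^ m.val) :=
  ⟨AddEquiv.refl _, fun _ _ => rfl⟩

def presentationB22 (ω : rootsOfUnity 4 (ZMod q)) : Presentation (B22 q ω)
    (fun m n => (m.2 * n.2, 0))
    (fun m : ZMod 2 × ZMod 2 => ω.1 ^ (2 * m.1.val + m.2.val)) :=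
  ⟨AddEquiv.refl _, fun _ _ => rfl⟩

def presentationB4 (ω μ : rootsOfUnity 2 (ZMod q)) : Presentation (B4 q ω μ)
    (fun m n => 2 * m * n)
    (fun m : ZMod 4 => ω.1 ^ (m.val / 2) * μ.1 ^ (m.val % 2)) :=
  ⟨AddEquiv.refl _, fun _ _ => rfl⟩

end StandardPresentations

/-! ### Braces of order 4 and their characters -/

section Classify

-- This is the case `f a b = g a * b`. Injectivity makes `1 + g a` odd, so `g` takes values in `{0,
-- 2}`, and the circle identity then makes `g 1` determine `g`. There are few enough functions to
-- check them all.
set_option maxRecDepth 20000 in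
theorem mul_eq_of_zmod_four (g : ZMod 4 → ZMod 4)
    (hinj : ∀ a, Function.Injective fun x => g a * x + x)
    (hg : ∀ a b, g (g a * b + a + b) = g a * g b + g a + g b) :
    (∀ a, g a = 0) ∨ ∀ a, g a = 2 * a := by
  revert hinj hg
  revert g
  decide

/-- This is the case `f m n = (g m * n.2, 0)`. If `g (1, 0) = 1`, then `(1, 0) ∘ (0, 1) = (0, 1)`,
which contradicts additivity of `g` along `∘`. Hence `g (1, 0) = 0`, and only `g (0, 1)` is free. -/
theorem eq_of_zmod_two_prod (g : ZMod 2 × ZMod 2 → ZMod 2)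
    (hg : ∀ a b, g (g a * b.2 + a.1 + b.1, a.2 + b.2) = g a + g b) :
    (∀ a, g a = 0) ∨ ∀ a, g a = a.2 := by
  revert g
  decide

theorem exists_addEquiv_apply_eq (v : ZMod 2 × ZMod 2) (hv : v ≠ 0) :
    ∃ φ : (ZMod 2 × ZMod 2) ≃+ (ZMod 2 × ZMod 2), φ v = (1, 0) := by
  have h : v = (1, 0) ∨ v = (0, 1) ∨ v = (1, 1) := by revert v; decide
  rcases h with rfl | rfl | rfl
  · exact ⟨AddEquiv.refl _, rfl⟩
  · exact ⟨AddEquiv.prodComm, rfl⟩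
  · exact ⟨⟨⟨fun m => (m.1, m.1 + m.2), fun m => (m.1, m.1 + m.2), by decide, by decide⟩,
      by decide⟩, rfl⟩

theorem forall_zmod_four {p : ZMod 4 → Prop} (h0 : p 0) (h1 : p 1) (h2 : p 2) (h3 : p 3) :
    ∀ m, p m := by
  intro m
  fin_cases m
  exacts [h0, h1, h2, h3]

theorem forall_zmod_two_prod {p : ZMod 2 × ZMod 2 → Prop} (h0 : p (0, 0)) (h1 : p (0, 1))
    (h2 : p (1, 0)) (h3 : p (1, 1)) : ∀ m, p m := by
  rintro ⟨x, y⟩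
  fin_cases x <;> fin_cases y
  exacts [h0, h1, h2, h3]

variable {A : Type*} [LeftBrace A] {q : ℕ}

/-- The circle group is cyclic with generator `1`, so `ω = χ 1`. -/
theorem nonempty_ringEquiv_T4 {χ : ZMod 4 → (ZMod q)ˣ}
    (P : Presentation A (fun _ _ => (0 : ZMod 4)) χ) : ∃ ω, Nonempty (A ≃+* T4 q ω) := by
  have h : ∀ a b, χ (a + b) = χ a * χ b := fun a b => by simpa using P.char_circ a b
  have h0 : χ 0 = 1 := by simpa using h 0 0
  have h2 : χ 2 = χ 1 ^ 2 := by rw [sq]; exact h 1 1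
  have h3 : χ 3 = χ 1 ^ 3 := by rw [pow_succ, ← h2]; exact h 2 1
  have h4 : χ 1 ^ 4 = 1 := by rw [pow_succ, ← h3, ← h0]; exact (h 3 1).symm
  refine ⟨⟨χ 1, h4⟩, ⟨P.ringEquiv (presentationT4 q _) (AddEquiv.refl _) (fun _ _ => rfl) ?_⟩⟩
  refine forall_zmod_four ?_ ?_ ?_ ?_
  · exact (pow_zero _).trans h0.symm
  · exact pow_one _
  · exact h2.symm
  · exact h3.symm

/-- Here `1 ∘ 1 = 2 ∘ 2 = 0` and `2 ∘ 1 = 3`: the circle group is a Klein four-group, with `ω = χ 2`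
and `μ = χ 1`. -/
theorem nonempty_ringEquiv_B4 {χ : ZMod 4 → (ZMod q)ˣ}
    (P : Presentation A (fun m n : ZMod 4 => 2 * m * n) χ) :
    ∃ ω μ, Nonempty (A ≃+* B4 q ω μ) := by
  have h : ∀ a b, χ (2 * a * b + a + b) = χ a * χ b := P.char_circ
  have h0 : χ 0 = 1 := by simpa using h 0 0
  have h1 : χ 1 ^ 2 = 1 := by rw [sq, ← h0]; exact (h 1 1).symm
  have h2 : χ 2 ^ 2 = 1 := by rw [sq, ← h0]; exact (h 2 2).symm
  have h3 : χ 3 = χ 2 * χ 1 := h 2 1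
  refine ⟨⟨χ 2, h2⟩, ⟨χ 1, h1⟩,
    ⟨P.ringEquiv (presentationB4 q _ _) (AddEquiv.refl _) (fun _ _ => rfl) ?_⟩⟩
  refine forall_zmod_four ?_ ?_ ?_ ?_
  · change χ 2 ^ 0 * χ 1 ^ 0 = χ 0
    rw [pow_zero, pow_zero, one_mul, h0]
  · change χ 2 ^ 0 * χ 1 ^ 1 = χ 1
    rw [pow_zero, pow_one, one_mul]
  · change χ 2 ^ 1 * χ 1 ^ 0 = χ 2
    rw [pow_zero, pow_one, mul_one]
  · change χ 2 ^ 1 * χ 1 ^ 1 = χ 3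
    rw [pow_one, pow_one, h3]

theorem nonempty_ringEquiv_T22 {χ : ZMod 2 × ZMod 2 → (ZMod q)ˣ}
    (P : Presentation A (fun _ _ => ((0, 0) : ZMod 2 × ZMod 2)) χ) :
    ∃ ω μ, Nonempty (A ≃+* T22 q ω μ) := by
  have h : ∀ a b, χ (a + b) = χ a * χ b := fun a b => by
    have := P.char_circ a b
    rwa [Prod.mk_zero_zero, zero_add] at this
  have h0 : χ 0 = 1 := by simpa using h 0 0
  have h1 : χ (1, 0) ^ 2 = 1 := by rw [sq, ← h0]; exact (h _ _).symm
  have h2 : χ (0, 1) ^ 2 = 1 := by rw [sq, ← h0]; exact (h _ _).symm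
  have h3 : χ (1, 1) = χ (1, 0) * χ (0, 1) := h (1, 0) (0, 1)
  refine ⟨⟨χ (1, 0), h1⟩, ⟨χ (0, 1), h2⟩,
    ⟨P.ringEquiv (presentationT22 q _ _) (AddEquiv.refl _) (fun _ _ => rfl) ?_⟩⟩
  refine forall_zmod_two_prod ?_ ?_ ?_ ?_
  · change χ (1, 0) ^ 0 * χ (0, 1) ^ 0 = χ 0
    rw [pow_zero, pow_zero, one_mul, h0]
  · change χ (1, 0) ^ 0 * χ (0, 1) ^ 1 = χ (0, 1)
    rw [pow_zero, pow_one, one_mul]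
  · change χ (1, 0) ^ 1 * χ (0, 1) ^ 0 = χ (1, 0)
    rw [pow_zero, pow_one, mul_one]
  · change χ (1, 0) ^ 1 * χ (0, 1) ^ 1 = χ (1, 1)
    rw [pow_one, pow_one, h3]

/-- The circle group is cyclic: the powers of `(0, 1)` are `(0, 0)`, `(0, 1)`, `(1, 0)`, `(1, 1)`,
whence the binary exponent of `ω = χ (0, 1)`. -/
theorem nonempty_ringEquiv_B22 {χ : ZMod 2 × ZMod 2 → (ZMod q)ˣ}
    (P : Presentation A (fun m n : ZMod 2 × ZMod 2 => (m.2 * n.2, 0)) χ) :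
    ∃ ω, Nonempty (A ≃+* B22 q ω) := by
  have h : ∀ a b : ZMod 2 × ZMod 2, χ ((a.2 * b.2, 0) + a + b) = χ a * χ b := P.char_circ
  have h0 : χ 0 = 1 := mul_eq_left.1 (h 0 0).symm
  have h2 : χ (1, 0) = χ (0, 1) ^ 2 := by rw [sq]; exact h (0, 1) (0, 1)
  have h3 : χ (1, 1) = χ (0, 1) ^ 3 := by rw [pow_succ, ← h2]; exact h (1, 0) (0, 1)
  have h4 : χ (0, 1) ^ 4 = 1 := by
    rw [pow_succ, ← h3, ← h0]; exact (h (1, 1) (0, 1)).symm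
  refine ⟨⟨χ (0, 1), h4⟩,
    ⟨P.ringEquiv (presentationB22 q _) (AddEquiv.refl _) (fun _ _ => rfl) ?_⟩⟩
  refine forall_zmod_two_prod ?_ ?_ ?_ ?_
  · exact (pow_zero _).trans h0.symm
  · exact pow_one _
  · exact h2.symm
  · exact h3.symm

theorem Presentation.classify_zmod_four {f : ZMod 4 → ZMod 4 → ZMod 4} {χ : ZMod 4 → (ZMod q)ˣ}
    (P : Presentation A f χ) :
    (∃ ω, Nonempty (A ≃+* T4 q ω)) ∨ ∃ ω μ, Nonempty (A ≃+* B4 q ω μ) := by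
  have hf : ∀ a b, f a b = f a 1 * b := fun a b => by
    have := ZMod.map_smul (AddMonoidHom.mk' (f a) (P.map_add a)) b 1
    simpa [mul_comm] using this
  have hcirc : ∀ a b, f (f a 1 * b + a + b) 1 = f a 1 * f b 1 + f a 1 + f b 1 := fun a b => by
    have := P.map_circ a b 1
    rwa [hf a b, hf a (f b 1)] at this
  rcases mul_eq_of_zmod_four (fun a => f a 1)
    (fun a => by simpa only [← hf] using P.injective a) hcirc with h | h
  · left
    obtain rfl : f = fun _ _ => 0 := by
      funext a b
      rw [hf, h, zero_mul]
    exact nonempty_ringEquiv_T4 P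
  · right
    obtain rfl : f = fun a b => 2 * a * b := by
      funext a b
      rw [hf, h]
    exact nonempty_ringEquiv_B4 P

theorem eq_fst_zero_of_ne (v : ZMod 2 × ZMod 2)
    (h1 : v ≠ (0, 1)) (h2 : v ≠ (1, 1)) : v = (v.1, 0) := by
  revert v; decide

theorem Presentation.classify_of_apply_eq_zero
    {f : ZMod 2 × ZMod 2 → ZMod 2 × ZMod 2 → ZMod 2 × ZMod 2}
    {χ : ZMod 2 × ZMod 2 → (ZMod q)ˣ} (P : Presentation A f χ) (hc : ∀ m, f m (1, 0) = 0) :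
    (∃ ω μ, Nonempty (A ≃+* T22 q ω μ)) ∨ ∃ ω, Nonempty (A ≃+* B22 q ω) := by
  have h0 : ∀ m, f m 0 = 0 := fun m => by simpa using P.map_add m 0 0
  -- The value `(0, 1)` would send `(0, 1)` and `0` to the same image under `x ↦ f m x + x`, and
  -- `(1, 1)` would do so for `(0, 1)` and `(1, 0)`.
  have hv : ∀ m, f m (0, 1) = ((f m (0, 1)).1, 0) := fun m => by
    refine eq_fst_zero_of_ne _ (fun h => ?_) (fun h => ?_)
    · exact absurd (P.injective m (a₁ := (0, 1)) (a₂ := 0) (by simp only [h, h0]; decide))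
        (by decide)
    · exact absurd (P.injective m (a₁ := (0, 1)) (a₂ := (1, 0)) (by simp only [h, hc]; decide))
        (by decide)
  have hf : ∀ m n, f m n = ((f m (0, 1)).1 * n.2, 0) := fun m => by
    have h1 := P.map_add m (1, 0) (0, 1)
    rw [hc, zero_add] at h1
    refine forall_zmod_two_prod ?_ ?_ ?_ ?_
    · rw [mul_zero]; exact h0 m
    · rw [mul_one]; exact hv m
    · rw [mul_zero]; exact hc m
    · rw [mul_one]; exact h1.trans (hv m)
  rcases eq_of_zmod_two_prod (fun m => (f m (0, 1)).1) (fun a b => by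
    have := congrArg Prod.fst (P.map_circ a b (0, 1))
    rw [hf a (f b (0, 1)), hf b (0, 1), hf a b] at this
    simpa [Prod.add_def] using this) with h | h
  · left
    obtain rfl : f = fun _ _ => (0, 0) := by
      funext a b
      rw [hf, h, zero_mul]
    exact nonempty_ringEquiv_T22 P
  · right
    obtain rfl : f = fun a b => (a.2 * b.2, 0) := by
      funext a b
      rw [hf, h]
    exact nonempty_ringEquiv_B22 P

theorem coprime_four {q : ℕ} (hq : q.Prime) (hq3 : 3 < q) : Nat.Coprime 4 q :=
  ((Nat.coprime_primes Nat.prime_two hq).2 (by omega)).pow_left 2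

/-- Every brace of order `4q` is of one of four shapes. -/
theorem classification (hq : q.Prime) (hq3 : 3 < q) (hA : Nat.card A = 4 * q) :
    ((∃ ω μ, Nonempty (A ≃+* T22 q ω μ)) ∨ ∃ ω, Nonempty (A ≃+* T4 q ω)) ∨
      (∃ ω, Nonempty (A ≃+* B22 q ω)) ∨ ∃ ω μ, Nonempty (A ≃+* B4 q ω μ) := by
  -- The torsion argument needs `4 < q`.
  have hne : q ≠ 4 := by rintro rfl; revert hq; decide
  have hcop := coprime_four hq hq3
  rcases addEquiv_of_card hq hcop hA with ⟨⟨e⟩⟩ | ⟨⟨e⟩⟩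
  · obtain ⟨f, χ, ⟨P⟩⟩ := exists_presentation hq e (by rw [Nat.card_zmod]; omega)
      (by rwa [Nat.card_zmod])
    exact P.classify_zmod_four.imp Or.inr Or.inr
  · have hM : Nat.card (ZMod 2 × ZMod 2) = 4 := by simp
    obtain ⟨f, χ, ⟨P⟩⟩ := exists_presentation hq e (by omega) (by rwa [hM])
    obtain ⟨c, hc0, hc⟩ := P.exists_ne_zero hq Nat.prime_two two_ne_zero hM (by omega) (by rwa [hM])
    obtain ⟨φ, hφ⟩ := exists_addEquiv_apply_eq c hc0
    refine ((P.trans φ).classify_of_apply_eq_zero fun m => ?_).imp Or.inl Or.inl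
    rw [← hφ, φ.symm_apply_apply, hc, map_zero]

end Classify

/-! ### Square roots and fourth roots of unity modulo `q` -/

section FourthRoots

variable {q : ℕ} [Fact q.Prime]

theorem unit_eq_one_or_eq_neg_one {u : (ZMod q)ˣ} (h : u ^ 2 = 1) : u = 1 ∨ u = -1 := by
  have h' : (u : ZMod q) ^ 2 = 1 := by rw [← Units.val_pow_eq_pow_val, h, Units.val_one]
  exact (sq_eq_one_iff.1 h').imp (fun h => Units.ext h) (fun h => Units.ext h)

theorem rootsOfUnity_two_eq (ω : rootsOfUnity 2 (ZMod q)) : ω = 1 ∨ ω = negOne₂ q :=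
  (unit_eq_one_or_eq_neg_one ω.2).imp (fun h => Subtype.ext h) (fun h => Subtype.ext h)

theorem rootsOfUnity_four_eq (ω : rootsOfUnity 4 (ZMod q)) :
    ω = 1 ∨ ω = negOne₄ q ∨ IsPrimitiveRoot (ω : (ZMod q)ˣ) 4 := by
  by_cases h : ω.1 ^ 2 = 1
  · exact (unit_eq_one_or_eq_neg_one h).imp (fun h => Subtype.ext h)
      (fun h => Or.inl (Subtype.ext h))
  · right; right
    have := Fact.mk Nat.prime_two
    have h4 : orderOf ω.1 = 2 ^ (1 + 1) :=
      orderOf_eq_prime_pow (by rwa [pow_one]) (show ω.1 ^ 4 = 1 from ω.2)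
    exact IsPrimitiveRoot.iff_orderOf.2 h4

/-- Both squares are `-1`, so `ω' * ω` is `1` or `-1 = ω ^ 2`. -/
theorem eq_or_eq_pow_three {ω ω' : rootsOfUnity 4 (ZMod q)}
    (h : IsPrimitiveRoot (ω : (ZMod q)ˣ) 4) (h' : IsPrimitiveRoot (ω' : (ZMod q)ˣ) 4) :
    ω' = ω ∨ ω' = ω ^ 3 := by
  have h2 : ∀ {ζ : rootsOfUnity 4 (ZMod q)}, IsPrimitiveRoot (ζ : (ZMod q)ˣ) 4 → ζ.1 ^ 2 = -1 :=
    fun {ζ} hζ => (unit_eq_one_or_eq_neg_one (u := ζ.1 ^ 2)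
      (by rw [← pow_mul]; exact ζ.2)).resolve_left (hζ.pow_ne_one_of_pos_of_lt (by decide)
        (by decide))
  have h3 : (ω'.1 * ω.1) ^ 2 = 1 := by rw [mul_pow, h2 h, h2 h']; simp
  have h4 : ω.1 ^ 4 = 1 := ω.2
  rcases unit_eq_one_or_eq_neg_one h3 with h5 | h5
  · right
    refine Subtype.ext ?_
    change ω'.1 = ω.1 ^ 3
    rw [eq_inv_of_mul_eq_one_left h5]
    exact (eq_inv_of_mul_eq_one_left (by rw [← pow_succ]; exact h4)).symm
  · left
    refine Subtype.ext ?_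
    rw [← h2 h, sq] at h5
    exact mul_right_cancel h5

theorem exists_primitive (h : 4 ∣ q - 1) :
    ∃ ω : rootsOfUnity 4 (ZMod q), IsPrimitiveRoot (ω : (ZMod q)ˣ) 4 := by
  have hc : 4 ∣ Nat.card (ZMod q)ˣ := by
    rwa [Nat.card_eq_fintype_card, ZMod.card_units]
  obtain ⟨u, hu⟩ := IsCyclic.exists_ofOrder_eq_natCard (α := (ZMod q)ˣ)
  obtain ⟨k, hk⟩ := hc
  have hp := (IsPrimitiveRoot.orderOf u).pow (by rw [hu]; exact Nat.card_pos)
    (show orderOf u = k * 4 by rw [hu, hk, mul_comm])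
  exact ⟨⟨u ^ k, hp.pow_eq_one⟩, hp⟩

theorem four_dvd_of_primitive {u : (ZMod q)ˣ} (h : IsPrimitiveRoot u 4) : 4 ∣ q - 1 := by
  rw [h.eq_orderOf, ← ZMod.card_units q]
  exact orderOf_dvd_card

end FourthRoots

/-! ### Coincidences among the models, and exhaustiveness of the lists -/

section Existence

variable {q : ℕ}

theorem T22_comm (ω μ : rootsOfUnity 2 (ZMod q)) : Nonempty (T22 q ω μ ≃+* T22 q μ ω) :=
  ⟨(presentationT22 q ω μ).ringEquiv (presentationT22 q μ ω) AddEquiv.prodComm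
    (fun _ _ => rfl) (fun _ => mul_comm _ _)⟩

theorem T22_self (ω : rootsOfUnity 2 (ZMod q)) : Nonempty (T22 q ω ω ≃+* T22 q ω 1) := by
  have hω : ω.1 ^ 2 = 1 := ω.2
  refine ⟨(presentationT22 q ω ω).ringEquiv (presentationT22 q ω 1)
    ⟨⟨fun m => (m.1 + m.2, m.2), fun m => (m.1 + m.2, m.2), by decide, by decide⟩, by decide⟩
    (fun _ _ => rfl) fun m => ?_⟩
  simp only [OneMemClass.coe_one, one_pow, mul_one, ← pow_add]
  refine pow_eq_of_mod hω ?_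
  revert m; decide

theorem T4_pow_three (ω : rootsOfUnity 4 (ZMod q)) : Nonempty (T4 q (ω ^ 3) ≃+* T4 q ω) := by
  have hω : ω.1 ^ 4 = 1 := ω.2
  refine ⟨(presentationT4 q (ω ^ 3)).ringEquiv (presentationT4 q ω) (AddEquiv.neg _)
    (fun _ _ => rfl) fun m => ?_⟩
  simp only [SubgroupClass.coe_pow, ← pow_mul]
  refine pow_eq_of_mod hω ?_
  revert m; decide

/-- The shear is inversion in the circle group, it preserves `y₁y₂`, and `ω ^ 3 = ω⁻¹`. -/
theorem B22_pow_three (ω : rootsOfUnity 4 (ZMod q)) : Nonempty (B22 q (ω ^ 3) ≃+* B22 q ω) := by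
  have hω : ω.1 ^ 4 = 1 := ω.2
  refine ⟨(presentationB22 q (ω ^ 3)).ringEquiv (presentationB22 q ω)
    ⟨⟨fun m => (m.1 + m.2, m.2), fun m => (m.1 + m.2, m.2), by decide, by decide⟩, by decide⟩
    (by decide) fun m => ?_⟩
  simp only [SubgroupClass.coe_pow, ← pow_mul]
  refine pow_eq_of_mod hω ?_
  revert m; decide

/-- Negation swaps `1` and `3 = 2 ∘ 1`, so it multiplies the value of the character at `1` by its
value at `2`. -/
theorem B4_self (ω : rootsOfUnity 2 (ZMod q)) : Nonempty (B4 q ω ω ≃+* B4 q ω 1) := by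
  have hω : ω.1 ^ 2 = 1 := ω.2
  refine ⟨(presentationB4 q ω ω).ringEquiv (presentationB4 q ω 1) (AddEquiv.neg _)
    (by decide) fun m => ?_⟩
  simp only [OneMemClass.coe_one, one_pow, mul_one, ← pow_add]
  refine pow_eq_of_mod hω ?_
  revert m; decide

variable {A : Type*} [LeftBrace A]

/-- Every brace of order `4q` is one of the nine or comes from a primitive fourth root of `1`. -/
theorem exists_nine_or (hq : q.Prime) (hq3 : 3 < q) (hA : Nat.card A = 4 * q) :
    (∃ i, Nonempty (A ≃+* nine q i)) ∨
      ∃ ω : rootsOfUnity 4 (ZMod q), IsPrimitiveRoot (ω : (ZMod q)ˣ) 4 ∧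
        (Nonempty (A ≃+* T4 q ω) ∨ Nonempty (A ≃+* B22 q ω)) := by
  have := Fact.mk hq
  rcases classification hq hq3 hA with
    (⟨ω, μ, ⟨e⟩⟩ | ⟨ω, ⟨e⟩⟩) | ⟨ω, ⟨e⟩⟩ | ⟨ω, μ, ⟨e⟩⟩
  · left
    rcases rootsOfUnity_two_eq ω with rfl | rfl <;> rcases rootsOfUnity_two_eq μ with rfl | rfl
    · exact ⟨0, ⟨e⟩⟩
    · exact ⟨1, (T22_comm _ _).map e.trans⟩
    · exact ⟨1, ⟨e⟩⟩
    · exact ⟨1, (T22_self _).map e.trans⟩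
  · rcases rootsOfUnity_four_eq ω with rfl | rfl | h
    · exact .inl ⟨2, ⟨e⟩⟩
    · exact .inl ⟨3, ⟨e⟩⟩
    · exact .inr ⟨ω, h, .inl ⟨e⟩⟩
  · rcases rootsOfUnity_four_eq ω with rfl | rfl | h
    · exact .inl ⟨4, ⟨e⟩⟩
    · exact .inl ⟨5, ⟨e⟩⟩
    · exact .inr ⟨ω, h, .inr ⟨e⟩⟩
  · left
    rcases rootsOfUnity_two_eq ω with rfl | rfl <;> rcases rootsOfUnity_two_eq μ with rfl | rfl
    · exact ⟨6, ⟨e⟩⟩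
    · exact ⟨7, ⟨e⟩⟩
    · exact ⟨8, ⟨e⟩⟩
    · exact ⟨8, (B4_self _).map e.trans⟩

theorem exists_nine (hq : q.Prime) (hq3 : 3 < q) (hA : Nat.card A = 4 * q) (h4 : ¬ 4 ∣ q - 1) :
    ∃ i, Nonempty (A ≃+* nine q i) := by
  have := Fact.mk hq
  exact (exists_nine_or hq hq3 hA).resolve_right fun ⟨_, hω, _⟩ => h4 (four_dvd_of_primitive hω)

theorem exists_eleven (hq : q.Prime) (hq3 : 3 < q) (hA : Nat.card A = 4 * q)
    {ω : rootsOfUnity 4 (ZMod q)} (hω : IsPrimitiveRoot (ω : (ZMod q)ˣ) 4) :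
    ∃ i, Nonempty (A ≃+* eleven q ω i) := by
  have := Fact.mk hq
  rcases exists_nine_or hq hq3 hA with ⟨i, hi⟩ | ⟨μ, hμ, ⟨⟨e⟩⟩ | ⟨⟨e⟩⟩⟩
  · exact ⟨.inl i, hi⟩
  · refine ⟨.inr 0, ?_⟩
    rcases eq_or_eq_pow_three hω hμ with rfl | rfl
    · exact ⟨e⟩
    · exact (T4_pow_three ω).map e.trans
  · refine ⟨.inr 1, ?_⟩
    rcases eq_or_eq_pow_three hω hμ with rfl | rfl
    · exact ⟨e⟩
    · exact (B22_pow_three ω).map e.trans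

end Existence

/-! ### Invariants separating the braces -/

section Profile

open scoped Classical in
/-- Five isomorphism invariants of a brace. -/
noncomputable def profile (q : ℕ) (B : Type*) [LeftBrace B] : Bool × Bool × Bool × Bool × Bool :=
  (decide (∀ a : B, (2 * q) • a = 0), decide (∀ a b : B, q • (a * b) = 0),
    decide (∀ a b : B, 4 • (a * b) = 0), decide (∀ a b : B, 4 • ((a * a + a + a) * b) = 0),
    decide (∀ a b : B, 4 • ((2 • a) * b) = 0))

theorem profile_congr (q : ℕ) {B C : Type*} [LeftBrace B] [LeftBrace C] (e : B ≃+* C) :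
    profile q B = profile q C := by
  have hs : ∀ (n : ℕ) (x : C), e.symm (n • x) = n • e.symm x := fun n x =>
    map_nsmul e.symm.toAddEquiv n x
  have h0 : ∀ x : C, e.symm x = 0 ↔ x = 0 := fun x =>
    map_eq_zero_iff e.symm.toAddEquiv e.symm.injective
  simp only [profile, Prod.mk.injEq, decide_eq_decide, e.symm.surjective.forall, ← hs, ← map_mul,
    ← map_add, h0, and_self]

namespace Presentation

variable {A M : Type*} [LeftBrace A] [AddCommGroup M] {q : ℕ} {f : M → M → M} {χ : M → (ZMod q)ˣ}

theorem forall_iff (P : Presentation A f χ) {p : M × ZMod q → Prop} :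
    (∀ a, p (P.equiv a)) ↔ ∀ m x, p (m, x) := by
  rw [P.equiv.forall_congr_left]
  simp

/-- Multiplying by `q` kills `ZMod q` and is injective on `M`; multiplying by `4` does the reverse.
The invariants thus test whether `M` has exponent dividing 2, whether `f` vanishes, and whether `χ`
is trivial on all of `M`, on circle squares and on additive doubles. -/
theorem profile_eq (P : Presentation A f χ) (hM : ∀ m : M, 4 • m = 0) (hq : Nat.Coprime 4 q)
    {b₀ b₁ b₂ b₃ b₄ : Bool} (hb₀ : b₀ = true ↔ ∀ m : M, 2 • m = 0)
    (hb₁ : b₁ = true ↔ ∀ m n, f m n = 0) (hb₂ : b₂ = true ↔ ∀ m, χ m = 1)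
    (hb₃ : b₃ = true ↔ ∀ m, χ (f m m + m + m) = 1) (hb₄ : b₄ = true ↔ ∀ m, χ (2 • m) = 1) :
    profile q A = (b₀, b₁, b₂, b₃, b₄) := by
  have hM' : ∀ m : M, q • m = 0 ↔ m = 0 := fun m =>
    ⟨fun h => eq_zero_of_coprime_nsmul hq (hM m) h, fun h => by rw [h, smul_zero]⟩
  have hZ : ∀ x : ZMod q, q • x = 0 := fun x => by simp
  have hZ' : ∀ x : ZMod q, 4 • x = 0 ↔ x = 0 := fun m =>
    ⟨fun h => eq_zero_of_coprime_nsmul hq h (hZ m), fun h => by rw [h, smul_zero]⟩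
  have hu : ∀ u : (ZMod q)ˣ, (∀ x : ZMod q, ((u : ZMod q) - 1) * x = 0) ↔ u = 1 := fun u =>
    ⟨fun h => Units.ext (by simpa [sub_eq_zero] using h 1), fun h x => by simp [h]⟩
  have h0 : ∀ a : A, a = 0 ↔ P.equiv a = 0 := fun a => by simp
  have h4 : ∀ t : A → M, (∀ a b : A, 4 • (((χ (t a) : ZMod q) - 1) * (P.equiv b).2) = 0) ↔
      ∀ a, χ (t a) = 1 := fun t => by
    refine forall_congr' fun a => ?_
    rw [P.forall_iff (p := fun z => 4 • (((χ (t a) : ZMod q) - 1) * z.2) = 0)]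
    simp only [hZ', forall_const, hu]
  simp only [profile, Prod.mk.injEq, Bool.eq_iff_iff (b := b₀), Bool.eq_iff_iff (b := b₁),
    Bool.eq_iff_iff (b := b₂), Bool.eq_iff_iff (b := b₃), Bool.eq_iff_iff (b := b₄),
    decide_eq_true_eq, hb₀, hb₁, hb₂, hb₃, hb₄]
  simp only [h0, map_nsmul, P.equiv_mul, _root_.map_add, Prod.smul_mk, Prod.mk_eq_zero, hM, hM',
    hZ, true_and, and_true, h4, Prod.fst_add, Prod.smul_fst]
  refine ⟨?_, ?_, ?_, ?_, ?_⟩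
  · rw [P.forall_iff (p := fun z => (2 * q) • z = 0)]
    simp only [Prod.smul_mk, Prod.mk_eq_zero, mul_comm 2 q, mul_smul, hM', hZ, and_true,
      forall_const]
  · rw [P.forall_iff (p := fun z => ∀ b, f z.1 (P.equiv b).1 = 0)]
    refine forall_congr' fun m => ?_
    simp only [forall_const]
    rw [P.forall_iff (p := fun z => f m z.1 = 0)]
    simp only [forall_const]
  · rw [P.forall_iff (p := fun z => χ z.1 = 1)]
    simp only [forall_const]
  · rw [P.forall_iff (p := fun z => χ (f z.1 z.1 + z.1 + z.1) = 1)]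
    simp only [forall_const]
  · rw [P.forall_iff (p := fun z => χ (2 • z.1) = 1)]
    simp only [forall_const]

end Presentation

variable {q : ℕ}

theorem profile_T22 (hq : Nat.Coprime 4 q) {ω μ : rootsOfUnity 2 (ZMod q)} {b : Bool}
    (h : b = true ↔ ω = 1 ∧ μ = 1) : profile q (T22 q ω μ) = (true, true, b, true, true) := by
  have h0 : ∀ m : ZMod 2 × ZMod 2, m + m = 0 := by decide
  refine (presentationT22 q ω μ).profile_eq (by decide) hq (by decide) (by decide) ?_ ?_ ?_
  · rw [h]
    refine ⟨?_, fun h => ⟨?_, ?_⟩⟩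
    · rintro ⟨rfl, rfl⟩ m
      simp
    · have h1 : ω.1 ^ 1 * μ.1 ^ 0 = 1 := h (1, 0)
      exact Subtype.ext (by simpa using h1)
    · have h1 : ω.1 ^ 0 * μ.1 ^ 1 = 1 := h (0, 1)
      exact Subtype.ext (by simpa using h1)
  · exact iff_of_true rfl fun m => by simp [add_assoc, h0]
  · exact iff_of_true rfl fun m => by rw [two_nsmul, h0]; simp

theorem profile_T4 (hq : Nat.Coprime 4 q) {ω : rootsOfUnity 4 (ZMod q)} {b c : Bool}
    (hb : b = true ↔ ω = 1) (hc : c = true ↔ ω ^ 2 = 1) :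
    profile q (T4 q ω) = (false, true, b, c, c) := by
  have h2 : ω ^ 2 = 1 ↔ ω.1 ^ 2 = 1 := by rw [Subtype.ext_iff]; rfl
  have h3 : (∀ m : ZMod 4, ω.1 ^ (m + m).val = 1) ↔ ω.1 ^ 2 = 1 := by
    refine ⟨fun h => h 1, fun h => forall_zmod_four ?_ ?_ ?_ ?_⟩
    exacts [pow_zero _, h, pow_zero _, h]
  refine (presentationT4 q ω).profile_eq (by decide) hq (by decide) (by decide) ?_ ?_ ?_
  · rw [hb]
    refine ⟨?_, fun h => Subtype.ext ((pow_one _).symm.trans (h 1))⟩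
    rintro rfl m
    exact one_pow _
  · simp only [zero_add, h3, hc, h2]
  · simp only [two_nsmul, h3, hc, h2]

theorem profile_B22 (hq : Nat.Coprime 4 q) {ω : rootsOfUnity 4 (ZMod q)} {b c : Bool}
    (hb : b = true ↔ ω = 1) (hc : c = true ↔ ω ^ 2 = 1) :
    profile q (B22 q ω) = (true, false, b, c, true) := by
  have h0 : ∀ m : ZMod 2 × ZMod 2, m + m = 0 := by decide
  refine (presentationB22 q ω).profile_eq (by decide) hq (by decide) (by decide) ?_ ?_ ?_
  · rw [hb]
    refine ⟨?_, fun h => Subtype.ext ((pow_one _).symm.trans (h (0, 1)))⟩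
    rintro rfl m
    exact one_pow _
  · rw [hc, Subtype.ext_iff]
    refine ⟨fun h => forall_zmod_two_prod ?_ ?_ ?_ ?_, fun h => h (0, 1)⟩
    exacts [pow_zero _, h, pow_zero _, h]
  · exact iff_of_true rfl fun m => by rw [two_nsmul, h0]; simp

/-- Circle squares vanish, but the additive double `2` has character value `ω`. The last invariant
is what separates the parameters `(1, -1)` and `(-1, 1)`. -/
theorem profile_B4 (hq : Nat.Coprime 4 q) {ω μ : rootsOfUnity 2 (ZMod q)} {b c : Bool}
    (hb : b = true ↔ ω = 1 ∧ μ = 1) (hc : c = true ↔ ω = 1) :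
    profile q (B4 q ω μ) = (false, false, b, true, c) := by
  have h0 : ∀ m : ZMod 4, 2 * m * m + m + m = 0 := by decide
  have hχ2 : ω.1 ^ 1 * μ.1 ^ 0 = 1 → ω = 1 := fun h => Subtype.ext (by simpa using h)
  refine (presentationB4 q ω μ).profile_eq (by decide) hq (by decide) (by decide) ?_ ?_ ?_
  · rw [hb]
    refine ⟨?_, fun h => ⟨hχ2 (h 2), ?_⟩⟩
    · rintro ⟨rfl, rfl⟩ m
      simp
    · have h1 : ω.1 ^ 0 * μ.1 ^ 1 = 1 := h 1
      exact Subtype.ext (by simpa using h1)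
  · exact iff_of_true rfl fun m => by simp [h0]
  · rw [hc]
    refine ⟨?_, fun h => hχ2 (h 1)⟩
    rintro rfl m
    have : (2 • m).val % 2 = 0 := by revert m; decide
    rw [this]
    simp

/-- The profiles of the nine braces. -/
def nineProfile : Fin 9 → Bool × Bool × Bool × Bool × Bool :=
  ![(true, true, true, true, true), (true, true, false, true, true),
    (false, true, true, true, true), (false, true, false, true, true),
    (true, false, true, true, true), (true, false, false, true, true),
    (false, false, true, true, true), (false, false, false, true, true),
    (false, false, false, true, false)]

/-- The profiles of the two braces attached to a primitive fourth root of `1`. -/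
def twoProfile : Fin 2 → Bool × Bool × Bool × Bool × Bool :=
  ![(false, true, false, false, false), (true, false, false, false, true)]

theorem negOne₂_ne_one (hq3 : 3 < q) : negOne₂ q ≠ 1 := fun h => by
  have : Fact (2 < q) := ⟨by omega⟩
  exact ZMod.neg_one_ne_one (congrArg (fun u : rootsOfUnity 2 (ZMod q) => (u.1 : ZMod q)) h)

theorem negOne₄_ne_one (hq3 : 3 < q) : negOne₄ q ≠ 1 := fun h => by
  have : Fact (2 < q) := ⟨by omega⟩
  exact ZMod.neg_one_ne_one (congrArg (fun u : rootsOfUnity 4 (ZMod q) => (u.1 : ZMod q)) h)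

theorem negOne₄_sq : negOne₄ q ^ 2 = 1 := Subtype.ext (neg_one_sq (R := (ZMod q)ˣ))

theorem profile_nine (hq : q.Prime) (hq3 : 3 < q) (i : Fin 9) :
    profile q (nine q i) = nineProfile i := by
  have hc := coprime_four hq hq3
  have h2 := negOne₂_ne_one hq3
  have h4 := negOne₄_ne_one hq3
  fin_cases i
  · exact profile_T22 hc (by simp)
  · exact profile_T22 hc (by simp [h2])
  · exact profile_T4 hc (by simp) (by simp)
  · exact profile_T4 hc (by simp [h4]) (by simp [negOne₄_sq])
  · exact profile_B22 hc (by simp) (by simp)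
  · exact profile_B22 hc (by simp [h4]) (by simp [negOne₄_sq])
  · exact profile_B4 hc (by simp) (by simp)
  · exact profile_B4 hc (by simp [h2]) (by simp)
  · exact profile_B4 hc (by simp [h2]) (by simp [h2])

theorem profile_two (hq : q.Prime) (hq3 : 3 < q) {ω : rootsOfUnity 4 (ZMod q)}
    (hω : IsPrimitiveRoot (ω : (ZMod q)ˣ) 4) (i : Fin 2) :
    profile q (two q ω i) = twoProfile i := by
  have hc := coprime_four hq hq3
  have h1 : ω ≠ 1 := fun h =>
    hω.pow_ne_one_of_pos_of_lt one_ne_zero (by decide) (by simp [h])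
  have h2 : ω ^ 2 ≠ 1 := fun h =>
    hω.pow_ne_one_of_pos_of_lt two_ne_zero (by decide) (congrArg Subtype.val h)
  fin_cases i
  · exact profile_T4 hc (by simp [h1]) (by simp [h2])
  · exact profile_B22 hc (by simp [h1]) (by simp [h2])

theorem nineProfile_injective : Function.Injective nineProfile := by decide

theorem elevenProfile_injective : Function.Injective (Sum.elim nineProfile twoProfile) := by
  decide

theorem profile_eleven (hq : q.Prime) (hq3 : 3 < q) {ω : rootsOfUnity 4 (ZMod q)}
    (hω : IsPrimitiveRoot (ω : (ZMod q)ˣ) 4) (i : Fin 9 ⊕ Fin 2) :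
    profile q (eleven q ω i) = Sum.elim nineProfile twoProfile i := by
  rcases i with i | i
  · exact profile_nine hq hq3 i
  · exact profile_two hq hq3 hω i

theorem existsUnique_of_profile {A : Type*} [LeftBrace A] {ι : Type*}
    {B : ι → CategoryTheory.Bundled.{0} LeftBrace} {t : ι → Bool × Bool × Bool × Bool × Bool}
    (ht : Function.Injective t) (hB : ∀ i, profile q (B i) = t i)
    (h : ∃ i, Nonempty (A ≃+* B i)) : ∃! i, Nonempty (A ≃+* B i) := by
  obtain ⟨i, ⟨e⟩⟩ := h
  refine ⟨i, ⟨e⟩, fun j ⟨e'⟩ => ht ?_⟩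
  rw [← hB, ← hB, ← profile_congr q e, ← profile_congr q e']

end Profile

end LeftBrace

theorem mainTheorem4 (q : ℕ) (hq : q.Prime) (hq3 : 3 < q)
    (A : Type*) [LeftBrace A] (hA : Nat.card A = 4 * q) :
    (¬ 4 ∣ q - 1 → ∃! i : Fin 9, Nonempty (A ≃+* LeftBrace.nine q i)) ∧
    (4 ∣ q - 1 →
      (∃ ω : rootsOfUnity 4 (ZMod q), IsPrimitiveRoot (ω : (ZMod q)ˣ) 4) ∧
      ∀ ω : rootsOfUnity 4 (ZMod q), IsPrimitiveRoot (ω : (ZMod q)ˣ) 4 →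
        ∃! i : Fin 9 ⊕ Fin 2, Nonempty (A ≃+* LeftBrace.eleven q ω i)) := by
  have := Fact.mk hq
  exact ⟨fun h4 => LeftBrace.existsUnique_of_profile LeftBrace.nineProfile_injective
      (LeftBrace.profile_nine hq hq3) (LeftBrace.exists_nine hq hq3 hA h4),
    fun h4 => ⟨LeftBrace.exists_primitive h4, fun ω hω =>
      LeftBrace.existsUnique_of_profile LeftBrace.elevenProfile_injective
        (LeftBrace.profile_eleven hq hq3 hω) (LeftBrace.exists_eleven hq hq3 hA hω)⟩⟩
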